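/- A \emph{represented space} $\mathbf X=(X,\delta_X)$ is a set $X$ with a partial surjection $\delta_X:\subseteq\mathbb N^{\mathbb N}\to X$; any $p$ with $\delta_X(p)=x$ is a \emph{name} of $x$. It carries the final topology along $\delta_X$, where $\operatorname{dom}(\delta_X)$ has the subspace topology of Baire space. The representation is \emph{admissible} if every partial continuous $\varphi:\subseteq\mathbb N^{\mathbb N}\to X$ factors as $\varphi=\delta_X\circ G$ on $\operatorname{dom}(\varphi)$ with $G$ partial continuous on Baire space. A partial $F:\subseteq\mathbb N^{\mathbb N}\to\mathbb N^{\mathbb N}$ is a \emph{realizer} of a partial multivalued function $f:\subseteq\mathbf X\rightrightarrows\mathbf Y$ if $\delta_Y(F(p))\in f(\delta_X(p))$ for all $p\in\operatorname{dom}(f\circ\delta_X)$. Write $f\leq^{\mathrm t}_{\mathrm W}g$ (topological Weihrauch reducibility) if there are partial continuous $H,K:\subseteq\mathbb N^{\mathbb N}\to\mathbb N^{\mathbb N}$ such that $p\mapsto K(\langle p,G(H(p))\rangle)$ is a realizer of $f$ whenever $G$ is a (not necessarily continuous) realizer of $g$. Let $\Sigma=\{\bot,\top\}$ be Sierpi\'nski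 space, where $0^\omega$ is the only name of $\bot$ and all other sequences are names of $\top$. Let $\mathcal O(\mathbf X)=\mathcal C(\mathbf X,\Sigma)$ be the represented space of open subsets of $\mathbf X$, where $\mathcal C(\mathbf X,\mathbf Y)$ is the space of continuously realizable functions, a name of $f$ being a code of a partial continuous function on Baire space that realizes $f$. Let $\mathcal V(\mathbf X)$ be the represented space of closed subsets $A$ of $\mathbf X$, where a name of $A$ is a name of $\{U\in\mathcal O(\mathbf X) : U\cap A\neq\emptyset\}$ in $\mathcal O(\mathcal O(\mathbf X))$. \emph{Overt choice} $\mathrm{VC}_{\mathbf X}:\subseteq\mathcal V(\mathbf X)\rightrightarrows\mathbf X$ maps each non-empty closed $A$ to the points of $A$. The function $\mathrm{LPO}:\mathbb N^{\mathbb N}\to\{0,1\}$ is given by $\mathrm{LPO}(r)=1$ if $r(k)=0$ for some $k$, and $\mathrm{LPO}(r)=0$ otherwise. A topological space is \emph{CoPolish} if it is the direct limit of an increasing sequence of compact metrizable subspaces, and \emph{Fr\'echet--Urysohn} if the closure of every subset $M$ is the set of all limits of sequences in $M$. \textbf{Theorem.} Let $\mathbf X$ be an admissibly represented space whose topology is CoPolish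 and Fr\'echet--Urysohn. Then $\mathrm{VC}_{\mathbf X}\leq^{\mathrm t}_{\mathrm W}\mathrm{LPO}$. -/

import Mathlib

namespace OvertChoice

universe u v w z

/-- Baire space, with the product topology of the discrete spaces `ℕ`. -/
abbrev Baire : Type := ℕ → ℕ

/-- A partial function on Baire space is continuous if it is continuous on its domain, where the
domain carries the subspace topology. -/
def ContinuousPartial (F : Baire →. Baire) : Prop :=
  Continuous (fun p : F.Dom => F.fn p.1 p.2)

/-- The pairing of Baire space: `p` on the even positions and `q` on the odd ones. -/
def pair (p q : Baire) : Baire := fun n => if n % 2 = 0 then p (n / 2) else q (n / 2)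

/-- The prefix of length `m` of `q`. -/
def initSeg (q : Baire) (m : ℕ) : List ℕ := (List.range m).map q

/-- The code of a number together with a finite word. -/
def code (n : ℕ) (w : List ℕ) : ℕ := Encodable.encode (n, w)

/-- The partial continuous function `η_p` on Baire space that is coded by `p`: the digit number `n`
of `η_p(q)` is `v` if `p` has the value `v + 1` at the shortest prefix of `q` on which
`p` (read at `n`) is not `0`; the value `η_p(q)` is defined if all its digits are. -/
def eta (p : Baire) : Baire →. Baire := fun q =>
  { Dom := ∀ n, ∃ m, p (code n (initSeg q m)) ≠ 0
    get := fun h n => p (code n (initSeg q (Nat.find (h n)))) - 1 }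

/-- A represented space: a set with a partial surjection from Baire space onto it, given by its
graph; `names p x` says that `p` is in the domain and is mapped to `x`. -/
structure RepSpace : Type (u + 1) where
  carrier : Type u
  names : Baire → carrier → Prop
  names_unique : ∀ {p x y}, names p x → names p y → x = y
  names_surj : ∀ x, ∃ p, names p x

instance : CoeSort RepSpace.{u} (Type u) := ⟨RepSpace.carrier⟩

namespace RepSpace

/-- The domain of the representation. -/
def dom (X : RepSpace.{u}) : Set Baire := {p | ∃ x, X.names p x}

/-- The representation, as a function on its domain. -/
noncomputable def rep (X : RepSpace.{u}) (p : X.dom) : X := p.2.choose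

theorem rep_eq_iff (X : RepSpace.{u}) (p : X.dom) (x : X) : X.rep p = x ↔ X.names p.1 x :=
  ⟨fun h => h ▸ p.2.choose_spec, fun h => X.names_unique p.2.choose_spec h⟩

/-- The topology of a represented space: the final topology along the representation, whose
domain carries the subspace topology. -/
noncomputable instance topology (X : RepSpace.{u}) : TopologicalSpace X :=
  TopologicalSpace.coinduced X.rep inferInstance

/-- The representation is admissible: every partial continuous function from Baire space
to the space lifts to a partial continuous function into the names. (The representation itself is
continuous, because the topology is the final one.) -/
def IsAdmissible (X : RepSpace.{u}) : Prop :=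
  ∀ (S : Set Baire) (φ : S → X), Continuous φ →
    ∃ G : S → Baire, Continuous G ∧ ∀ s, X.names (G s) (φ s)

end RepSpace

/-- A partial multivalued function between represented spaces: `f x` is the set of the values at
`x`, and `x` is in the domain of `f` if this set is not empty. -/
abbrev MultiFun (X : RepSpace.{u}) (Y : RepSpace.{v}) : Type (max u v) := X → Set Y

/-- `F` is a realizer of the partial multivalued function `f`. -/
def Realizes {X : RepSpace.{u}} {Y : RepSpace.{v}} (F : Baire →. Baire) (f : MultiFun X Y) : Prop :=
  ∀ p x, X.names p x → (f x).Nonempty → ∃ q ∈ F p, ∃ y ∈ f x, Y.names q y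

/-- A (total, single-valued) function between represented spaces is continuous if it has a
continuous realizer. -/
def RepContinuous {X : RepSpace.{u}} {Y : RepSpace.{v}} (f : X → Y) : Prop :=
  ∃ F : Baire →. Baire, ContinuousPartial F ∧ Realizes F (fun x => ({f x} : Set Y))

/-- Topological Weihrauch reducibility. -/
def TopWeihrauchLE {X : RepSpace.{u}} {Y : RepSpace.{v}} {U : RepSpace.{w}} {V : RepSpace.{z}}
    (f : MultiFun X Y) (g : MultiFun U V) : Prop :=
  ∃ H K : Baire →. Baire, ContinuousPartial H ∧ ContinuousPartial K ∧
    ∀ G : Baire →. Baire, Realizes G g →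
      Realizes (fun p => (H p).bind fun q => (G q).bind fun r => K (pair p r)) f

section helpers

theorem initSeg_eq_iff (p q : Baire) (m : ℕ) :
    initSeg p m = initSeg q m ↔ ∀ i < m, p i = q i := by
  simp [initSeg]

theorem isOpen_cylinder (q : Baire) (m : ℕ) : IsOpen {p : Baire | ∀ i < m, p i = q i} := by
  have : {p : Baire | ∀ i < m, p i = q i} = (Set.Iio m).pi (fun i => {q i}) := by
    ext p; simp [Set.mem_pi]
  rw [this]
  exact isOpen_set_pi (Set.finite_Iio m) (fun _ _ => isOpen_discrete _)

theorem exists_cylinder {W : Set Baire} (hW : IsOpen W) {q : Baire} (hq : q ∈ W) :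
    ∃ m, ∀ p : Baire, (∀ i < m, p i = q i) → p ∈ W := by
  obtain ⟨I, t, h1, h2⟩ := isOpen_pi_iff.1 hW q hq
  refine ⟨I.sup id + 1, fun p hp => h2 fun i hi => ?_⟩
  rw [hp i (Nat.lt_succ_of_le (Finset.le_sup (f := id) hi))]
  exact (h1 i hi).2

open Classical in
/-- Every partial continuous function on Baire space extends to one of the form `η_p`. -/
theorem exists_eta_extends {F : Baire →. Baire} (hF : ContinuousPartial F) :
    ∃ p, ∀ q r, r ∈ F q → r ∈ eta p q := by
  let good : ℕ → List ℕ → ℕ → Prop := fun n w v =>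
    (∃ q r m, r ∈ F q ∧ initSeg q m = w) ∧
      ∀ q r m, r ∈ F q → initSeg q m = w → r n = v
  let p : Baire := fun k => match (Encodable.decode k : Option (ℕ × List ℕ)) with
    | none => 0
    | some (n, w) => if h : ∃ v, good n w v then h.choose + 1 else 0
  have hp : ∀ n w, p (code n w) = if h : ∃ v, good n w v then h.choose + 1 else 0 := by
    intro n w; simp only [p, code, Encodable.encodek]
  refine ⟨p, fun q r hr => ?_⟩
  have hval : ∀ n m, p (code n (initSeg q m)) ≠ 0 → p (code n (initSeg q m)) = r n + 1 := by
    intro n m h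
    rw [hp] at h ⊢
    split_ifs at h ⊢ with hv
    · rw [hv.choose_spec.2 q r m hr rfl]
    · exact absurd rfl h
  have hex : ∀ n, ∃ m, p (code n (initSeg q m)) ≠ 0 := by
    intro n
    obtain ⟨hd, hg⟩ := hr
    have hc : Continuous (fun a : F.Dom => F.fn a.1 a.2 n) := (continuous_apply n).comp hF
    have ho : IsOpen ((fun a : F.Dom => F.fn a.1 a.2 n) ⁻¹' {r n}) :=
      (isOpen_discrete _).preimage hc
    obtain ⟨W, hW, hWe⟩ := isOpen_induced_iff.1 ho
    have hqW : q ∈ W := by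
      have : (⟨q, hd⟩ : F.Dom) ∈ ((↑) : F.Dom → Baire) ⁻¹' W := by
        rw [hWe]; exact congrFun hg n
      exact this
    obtain ⟨m, hm⟩ := exists_cylinder hW hqW
    refine ⟨m, ?_⟩
    have hgood : good n (initSeg q m) (r n) := by
      refine ⟨⟨q, r, m, ⟨hd, hg⟩, rfl⟩, fun q1 r1 m1 hr1 h1 => ?_⟩
      have hmm : m1 = m := by simpa [initSeg] using congrArg List.length h1
      subst hmm
      obtain ⟨hd1, hg1⟩ := hr1
      have : (⟨q1, hd1⟩ : F.Dom) ∈ ((↑) : F.Dom → Baire) ⁻¹' W :=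
        hm q1 ((initSeg_eq_iff _ _ _).1 h1)
      rw [hWe] at this
      rw [← hg1]
      exact this
    rw [hp, dif_pos ⟨_, hgood⟩]
    exact Nat.succ_ne_zero _
  refine ⟨hex, funext fun n => ?_⟩
  change p (code n (initSeg q (Nat.find (hex n)))) - 1 = r n
  rw [hval n _ (Nat.find_spec (hex n))]
  rfl

open Classical in
/-- Membership in an open subset of Baire space is semidecided by a continuous function. -/
theorem exists_semidecision {S : Set Baire} (hS : IsOpen S) :
    ∃ F : Baire → Baire, Continuous F ∧ ∀ a, a ∈ S ↔ ∃ n, F a n ≠ 0 := by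
  let F : Baire → Baire := fun a k => if ∀ b : Baire, (∀ i < k, b i = a i) → b ∈ S then 1 else 0
  have hFc : Continuous F := by
    refine continuous_pi fun k => continuous_discrete_rng.2 fun v => ?_
    rw [isOpen_iff_forall_mem_open]
    intro a ha
    refine ⟨{b | ∀ i < k, b i = a i}, fun b hb => ?_, isOpen_cylinder a k, by simp⟩
    have : F b k = F a k := by
      simp only [F]
      congr 1
      apply propext
      refine forall_congr' fun c => ?_
      have : (∀ i < k, c i = b i) ↔ (∀ i < k, c i = a i) :=
        forall_congr' fun i => forall_congr' fun hi => by rw [hb i hi]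
      rw [this]
    change F b k = v
    rw [this]; exact ha
  have hFS : ∀ a, a ∈ S ↔ ∃ n, F a n ≠ 0 := by
    intro a
    constructor
    · intro h
      obtain ⟨m, hm⟩ := exists_cylinder hS h
      refine ⟨m, ?_⟩
      simp only [F]
      rw [if_pos hm]
      exact one_ne_zero
    · rintro ⟨n, hn⟩
      by_contra h
      apply hn
      simp only [F]
      exact if_neg fun hb => h (hb a fun _ _ => rfl)
  exact ⟨F, hFc, hFS⟩

end helpers

namespace RepSpace

/-- The space `C(X, Y)` of the continuous functions from `X` to `Y`: a name of `f` is a `p` such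
that `η_p` is a realizer of `f`. -/
def funSpace (X : RepSpace.{u}) (Y : RepSpace.{v}) : RepSpace.{max u v} where
  carrier := {f : X → Y // RepContinuous f}
  names p f := Realizes (eta p) (fun x => ({f.1 x} : Set Y))
  names_unique := by
    intro p f g hf hg
    apply Subtype.ext
    funext x
    obtain ⟨q, hq⟩ := X.names_surj x
    obtain ⟨r, hr, y, hy, hy1⟩ := hf q x hq ⟨_, rfl⟩
    obtain ⟨r2, hr2, y2, hy2, hy3⟩ := hg q x hq ⟨_, rfl⟩
    obtain rfl := Part.mem_unique hr hr2
    rw [Set.mem_singleton_iff] at hy hy2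
    subst hy hy2
    exact Y.names_unique hy1 hy3
  names_surj := by
    rintro ⟨f, F, hF, hFf⟩
    obtain ⟨p, hp⟩ := exists_eta_extends hF
    refine ⟨p, fun q x hq hx => ?_⟩
    obtain ⟨r, hr, h⟩ := hFf q x hq hx
    exact ⟨r, hp q r hr, h⟩

/-- Sierpinski space, with underlying set `Prop`: the only name of `⊥ = False` is the constant
sequence `0`; all other sequences are names of `⊤ = True`. -/
def sierpinski : RepSpace.{0} where
  carrier := Prop
  names p b := b ↔ ∃ n, p n ≠ 0
  names_unique := fun h1 h2 => propext (h1.trans h2.symm)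
  names_surj := by
    intro b
    by_cases hb : b
    · exact ⟨fun _ => 1, by simp [hb]⟩
    · exact ⟨fun _ => 0, by simp [hb]⟩

/-- The space `O(X)` of the open sets, which are identified with their continuous characteristic
functions into Sierpinski space. -/
def opens (X : RepSpace.{u}) : RepSpace.{u} := funSpace X sierpinski

/-- The family of the open sets that meet `A`, as a characteristic function on `O(X)`. -/
def meets {X : RepSpace.{u}} (A : Set X) : X.opens → sierpinski :=
  fun U => ∃ x ∈ A, U.1 x

open Classical in
theorem repContinuous_meets {X : RepSpace.{u}} (A : Set X) : RepContinuous (meets A) := by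
  let S : Set Baire := {a | ∃ q x n m, X.names q x ∧ x ∈ A ∧ 1 < a (code n (initSeg q m)) ∧
    ∀ k < m, a (code n (initSeg q k)) = 0}
  have hS : IsOpen S := by
    rw [isOpen_iff_forall_mem_open]
    rintro a ⟨q, x, n, m, hq, hx, h1, h2⟩
    refine ⟨(⋂ k ∈ Set.Iio (m + 1), {b : Baire |
      b (code n (initSeg q k)) = a (code n (initSeg q k))}), ?_, ?_, ?_⟩
    · intro b hb
      simp only [Set.mem_iInter, Set.mem_Iio, Set.mem_ofPred_eq] at hb
      refine ⟨q, x, n, m, hq, hx, ?_, fun k hk => ?_⟩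
      · rw [hb m (by omega)]; exact h1
      · rw [hb k (by omega)]; exact h2 k hk
    · refine (Set.finite_Iio _).isOpen_biInter fun k _ => ?_
      have h : Continuous fun b : Baire => b (code n (initSeg q k)) := continuous_apply _
      exact h.isOpen_preimage {a (code n (initSeg q k))} (isOpen_discrete _)
    · simp
  have hmem : ∀ a (U : X.opens), X.opens.names a U → (a ∈ S ↔ meets A U) := by
    intro a U haU
    have key : ∀ q x, X.names q x → ∃ r ∈ eta a q, (U.1 x ↔ ∃ n, r n ≠ 0) := by
      intro q x hq
      obtain ⟨r, hr, y, hy, hry⟩ := haU q x hq ⟨_, rfl⟩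
      rw [Set.mem_singleton_iff] at hy
      subst hy
      exact ⟨r, hr, hry⟩
    constructor
    · rintro ⟨q, x, n, m, hq, hx, h1, h2⟩
      obtain ⟨r, ⟨hd, hr⟩, hU⟩ := key q x hq
      refine ⟨x, hx, hU.2 ⟨n, ?_⟩⟩
      have hm : Nat.find (hd n) = m :=
        (Nat.find_eq_iff _).2 ⟨by omega, fun k hk => by simpa using h2 k hk⟩
      have hrn : a (code n (initSeg q (Nat.find (hd n)))) - 1 = r n := congrFun hr n
      rw [hm] at hrn
      omega
    · rintro ⟨x, hx, hUx⟩
      obtain ⟨q, hq⟩ := X.names_surj x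
      obtain ⟨r, ⟨hd, hr⟩, hU⟩ := key q x hq
      obtain ⟨n, hn⟩ := hU.1 hUx
      have hrn : a (code n (initSeg q (Nat.find (hd n)))) - 1 = r n := congrFun hr n
      exact ⟨q, x, n, Nat.find (hd n), hq, hx, by omega,
        fun k hk => by simpa using Nat.find_min (hd n) hk⟩
  obtain ⟨F, hFc, hFS⟩ := exists_semidecision hS
  refine ⟨F, hFc.comp continuous_subtype_val, fun a U haU _ => ?_⟩
  refine ⟨F a, Part.mem_some _, meets A U, rfl, ?_⟩
  exact (hmem a U haU).symm.trans (hFS a)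

theorem repContinuous_of_isOpen {X : RepSpace.{u}} {U : Set X} (hU : IsOpen U) :
    RepContinuous (X := X) (Y := sierpinski) (fun x => x ∈ U) := by
  have ho : IsOpen (X.rep ⁻¹' U) := isOpen_coinduced.1 hU
  obtain ⟨W, hW, hWe⟩ := isOpen_induced_iff.1 ho
  obtain ⟨F, hFc, hFW⟩ := exists_semidecision hW
  refine ⟨F, hFc.comp continuous_subtype_val, fun a x hax _ => ?_⟩
  refine ⟨F a, Part.mem_some _, x ∈ U, rfl, Iff.trans ?_ (hFW a)⟩
  have hx : X.rep ⟨a, x, hax⟩ = x := (X.rep_eq_iff _ _).2 hax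
  have h : (⟨a, x, hax⟩ : X.dom) ∈ ((↑) : X.dom → Baire) ⁻¹' W ↔
      (⟨a, x, hax⟩ : X.dom) ∈ X.rep ⁻¹' U := by rw [hWe]
  rw [Set.mem_preimage, Set.mem_preimage, hx] at h
  exact h.symm

/-- The space `V(X)` of the overt closed subsets of `X`: a name of `A` is a name, in `O(O(X))`, of
the family of the open sets that meet `A`. -/
def overt (X : RepSpace.{u}) : RepSpace.{u} where
  carrier := {A : Set X // IsClosed A}
  names p A := X.opens.opens.names p ⟨meets A.1, repContinuous_meets A.1⟩
  names_unique := by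
    have sub : ∀ A B : {A : Set X // IsClosed A}, meets A.1 = meets B.1 → A.1 ⊆ B.1 := by
      intro A B h x hx
      by_contra hxB
      have h1 := congrFun h ⟨_, repContinuous_of_isOpen B.2.isOpen_compl⟩
      obtain ⟨y, hy, hyc⟩ := Eq.mp h1 ⟨x, hx, hxB⟩
      exact hyc hy
    intro p A B hA hB
    have h := congrArg Subtype.val (X.opens.opens.names_unique hA hB)
    exact Subtype.ext (Set.Subset.antisymm (sub A B h) (sub B A h.symm))
  names_surj := fun A => X.opens.opens.names_surj ⟨meets A.1, repContinuous_meets A.1⟩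

/-- Baire space, represented by the identity. -/
def baire : RepSpace.{0} where
  carrier := Baire
  names p q := p = q
  names_unique := fun h1 h2 => h1.symm.trans h2
  names_surj := fun q => ⟨q, rfl⟩

/-- The discrete space `{0, 1}`: the names of `b` are the sequences that start with `b`. -/
def two : RepSpace.{0} where
  carrier := Fin 2
  names p b := p 0 = b.val
  names_unique := fun h1 h2 => Fin.ext (h1.symm.trans h2)
  names_surj := fun b => ⟨fun _ => b.val, rfl⟩

end RepSpace

/-- Overt choice on `X`: given a nonempty closed set `A` as an element of `V(X)`, find a point of `A`.
The empty set is outside the domain. -/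
def VC (X : RepSpace.{u}) : MultiFun X.overt X := fun A => A.1

open Classical in
/-- `LPO r = 1` if `r` takes the value `0`, and `LPO r = 0` otherwise. -/
noncomputable def LPO : MultiFun RepSpace.baire RepSpace.two :=
  fun r : Baire => {if ∃ k, r k = 0 then (1 : Fin 2) else (0 : Fin 2)}

/-- A CoPolish space: the direct limit of an increasing sequence of compact metrizable subspaces. -/
def IsCoPolish (X : Type u) [TopologicalSpace X] : Prop :=
  ∃ K : ℕ → Set X, Monotone K ∧ (∀ k, IsCompact (K k)) ∧
    (∀ k, TopologicalSpace.MetrizableSpace (K k)) ∧ (⋃ k, K k) = Set.univ ∧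
    Topology.IsCoherentWith (Set.range K)

end OvertChoice

/-! Let `U` be the union of the interiors of the compact sets `K k`. Whether an overt set `A` meets
`U` is an open condition on its name, so one query to `LPO` decides it. On each side of this
decision a point of `A` can be chosen continuously.

If `A` meets `U`, it meets some `interior (K k)`. Such a `k` can be found locally constantly in the
name, and successively smaller balls in the compact metric space `K k` converge to a point of `A`
(`exists_continuous_selection`).

Otherwise `A` lies in `singularSet K`. By the Fréchet–Urysohn property this set meets each `K k` in
a finite set (`finite_singularSet_inter`), so it is countable and all its subsets are closed.
Membership of a given singular point in `A` is then semidecidable, and a search finds a member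
(`exists_continuous_selection_of_discrete`).

Admissibility turns the continuous choice of a point into a continuous choice of a name. -/

namespace OvertChoice

open Set Filter Topology

/-! ### Singular points of a Fréchet–Urysohn CoPolish space -/

section CoPolish

variable {X : Type*} [TopologicalSpace X] {K : ℕ → Set X}

/-- The points without a neighbourhood among the sets `K k`. -/
def singularSet (K : ℕ → Set X) : Set X := (⋃ k, interior (K k))ᶜ

theorem isClosed_of_finite_inter (hmet : ∀ k, TopologicalSpace.MetrizableSpace (K k))
    (hcoh : IsCoherentWith (range K)) {E : Set X} (hE : ∀ k, (E ∩ K k).Finite) : IsClosed E := by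
  rw [hcoh.isClosed_iff]
  rintro _ ⟨k, rfl⟩
  have := hmet k
  refine Finite.isClosed (Finite.of_finite_image ?_ Subtype.val_injective.injOn)
  rw [Subtype.image_preimage_coe, inter_comm]
  exact hE k

/-- No separation axiom on `X` is needed: `C` and `K l` both lie in the Hausdorff space `K (max l
m)`, where `C` is closed. -/
theorem isClosed_of_isCompact_of_subset (hmono : Monotone K)
    (hmet : ∀ k, TopologicalSpace.MetrizableSpace (K k))
    (hcoh : IsCoherentWith (range K)) {C : Set X} (hC : IsCompact C) {m : ℕ} (hCm : C ⊆ K m) :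
    IsClosed C := by
  rw [hcoh.isClosed_iff]
  rintro _ ⟨l, rfl⟩
  have := hmet (max l m)
  have h : IsClosed ((↑) ⁻¹' C : Set (K (max l m))) := by
    refine IsCompact.isClosed ?_
    rw [Topology.IsInducing.subtypeVal.isCompact_iff, Subtype.image_preimage_coe,
      inter_eq_self_of_subset_right (hCm.trans (hmono (le_max_right l m)))]
    exact hC
  exact h.preimage (continuous_inclusion (hmono (le_max_left l m)))

theorem exists_forall_mem_of_tendsto (hmono : Monotone K)
    (hmet : ∀ k, TopologicalSpace.MetrizableSpace (K k)) (hcover : (⋃ k, K k) = univ)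
    (hcoh : IsCoherentWith (range K)) {y : ℕ → X} {x : X} (h : Tendsto y atTop (𝓝 x)) :
    ∃ m, ∀ j, y j ∈ K m := by
  by_contra! hcon
  choose j hj using hcon
  have hex : ∀ a, ∃ k, a ∈ K k := fun a => mem_iUnion.1 (hcover ▸ mem_univ a)
  choose r hr using hex
  let E : Set X := (fun m => y (j m)) '' Ici (r x)
  have hE : IsClosed E := by
    refine isClosed_of_finite_inter hmet hcoh fun l => ?_
    refine ((finite_Iio l).image fun m => y (j m)).subset ?_
    rintro _ ⟨⟨m, -, rfl⟩, hm⟩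
    exact ⟨m, lt_of_not_ge fun hlm => hj m (hmono hlm hm), rfl⟩
  have hx : x ∉ E := by
    rintro ⟨m, hm, he⟩
    refine hj m (hmono hm ?_)
    have he' : y (j m) = x := he
    rw [he']
    exact hr x
  obtain ⟨J, hJ⟩ := eventually_atTop.1 (h.eventually (hE.isOpen_compl.mem_nhds hx))
  -- `K M` contains every `y i` with `i < J`, which forces `J ≤ j M`.
  let M := max (r x) ((Finset.range J).sup fun i => r (y i))
  rcases le_or_gt J (j M) with hle | hlt
  · exact hJ _ hle ⟨M, mem_Ici.2 (le_max_left _ _), rfl⟩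
  · refine hj M (hmono ?_ (hr (y (j M))))
    exact (Finset.le_sup (f := fun i => r (y i)) (Finset.mem_range.2 hlt)).trans (le_max_right _ _)

/-- Otherwise singular points `u n` converge to some `x`, and each `u n` is the limit of a row `y n`
outside `K n`. A single sequence drawn from the rows would converge to `x`; it stays in one `K m`,
so it uses only the rows below `m`. These rows with their limits form a closed set that omits `x`.
-/
theorem finite_singularSet_inter [FrechetUrysohnSpace X] (hmono : Monotone K)
    (hcpt : ∀ k, IsCompact (K k))
    (hmet : ∀ k, TopologicalSpace.MetrizableSpace (K k)) (hcover : (⋃ k, K k) = univ)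
    (hcoh : IsCoherentWith (range K)) (k : ℕ) : (singularSet K ∩ K k).Finite := by
  by_contra hinf
  obtain ⟨x, -, hacc⟩ := Set.Infinite.exists_accPt_of_subset_isCompact hinf (hcpt k)
    inter_subset_right
  rw [accPt_principal_iff_nhdsWithin, ← mem_closure_iff_nhdsWithin_neBot,
    mem_closure_iff_seq_limit] at hacc
  obtain ⟨u, hu, hux⟩ := hacc
  have hseq : ∀ n, ∃ y : ℕ → X, (∀ m, y m ∉ K n ∧ y m ≠ x) ∧ Tendsto y atTop (𝓝 (u n)) := by
    intro n
    have hcl : u n ∈ closure (K n)ᶜ := by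
      rw [closure_compl]
      intro hi
      exact (hu n).1.1 (mem_iUnion.2 ⟨n, hi⟩)
    have hx : IsClosed ({x} : Set X) :=
      isClosed_of_finite_inter hmet hcoh fun _ => (finite_singleton x).inter_of_left _
    have hcl2 : u n ∈ closure ((K n)ᶜ ∩ {x}ᶜ) :=
      inter_comm {x}ᶜ (K n)ᶜ ▸ hx.isOpen_compl.inter_closure ⟨(hu n).2, hcl⟩
    obtain ⟨y, hy, hyt⟩ := mem_closure_iff_seq_limit.1 hcl2
    exact ⟨y, hy, hyt⟩
  choose y hy hyt using hseq
  have hC : ∀ n, IsClosed (insert (u n) (range (y n))) := by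
    intro n
    obtain ⟨m, hm⟩ := exists_forall_mem_of_tendsto hmono hmet hcover hcoh (hyt n)
    obtain ⟨m', hm'⟩ := mem_iUnion.1 (hcover ▸ mem_univ (u n))
    refine isClosed_of_isCompact_of_subset hmono hmet hcoh (hyt n).isCompact_insert_range
      (m := max m m') (insert_subset (hmono (le_max_right _ _) hm') ?_)
    rintro _ ⟨i, rfl⟩
    exact hmono (le_max_left _ _) (hm i)
  have hxM : x ∈ closure (⋃ n, range (y n)) := by
    refine isClosed_closure.mem_of_tendsto hux (Eventually.of_forall fun n => ?_)
    refine mem_closure_of_tendsto (hyt n) (Eventually.of_forall fun i => ?_)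
    exact mem_iUnion.2 ⟨n, i, rfl⟩
  -- The Fréchet–Urysohn property replaces the iterated limit by a single one.
  obtain ⟨z, hz, hzx⟩ := mem_closure_iff_seq_limit.1 hxM
  obtain ⟨m, hm⟩ := exists_forall_mem_of_tendsto hmono hmet hcover hcoh hzx
  have hcl : IsClosed (⋃ n ∈ Iio m, insert (u n) (range (y n))) :=
    (finite_Iio m).isClosed_biUnion fun n _ => hC n
  have hmem : x ∈ ⋃ n ∈ Iio m, insert (u n) (range (y n)) := by
    refine hcl.mem_of_tendsto hzx (Eventually.of_forall fun i => ?_)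
    obtain ⟨n, l, hl⟩ := mem_iUnion.1 (hz i)
    refine mem_biUnion (x := n) ?_ (Or.inr ⟨l, hl⟩)
    refine lt_of_not_ge fun hmn => (hy n l).1 (hmono hmn ?_)
    rw [hl]
    exact hm i
  obtain ⟨n, -, hn⟩ := mem_iUnion₂.1 hmem
  rcases hn with hn | ⟨l, hl⟩
  · exact (hu n).2 hn.symm
  · exact (hy n l).2 hl

theorem countable_singularSet [FrechetUrysohnSpace X] (hmono : Monotone K)
    (hcpt : ∀ k, IsCompact (K k))
    (hmet : ∀ k, TopologicalSpace.MetrizableSpace (K k)) (hcover : (⋃ k, K k) = univ)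
    (hcoh : IsCoherentWith (range K)) : (singularSet K).Countable := by
  rw [← inter_univ (singularSet K), ← hcover, inter_iUnion]
  exact countable_iUnion fun k =>
    (finite_singularSet_inter hmono hcpt hmet hcover hcoh k).countable

theorem isClosed_of_subset_singularSet [FrechetUrysohnSpace X] (hmono : Monotone K)
    (hcpt : ∀ k, IsCompact (K k))
    (hmet : ∀ k, TopologicalSpace.MetrizableSpace (K k)) (hcover : (⋃ k, K k) = univ)
    (hcoh : IsCoherentWith (range K)) {E : Set X} (hE : E ⊆ singularSet K) : IsClosed E :=
  isClosed_of_finite_inter hmet hcoh fun k =>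
    (finite_singularSet_inter hmono hcpt hmet hcover hcoh k).subset
      (inter_subset_inter_left _ hE)

end CoPolish

/-! ### Continuous selections over subspaces of Baire space -/

section Selection

variable {P : Type*} [TopologicalSpace P] {e : P → Baire}

/-- Run the semidecision procedures of all `O i` in parallel and take the first that succeeds; the
outcome depends on finitely many digits. -/
theorem exists_isLocallyConstant_selection (he : IsInducing e) {O : ℕ → Set P}
    (hO : ∀ i, IsOpen (O i)) (hcov : ∀ p, ∃ i, p ∈ O i) :
    ∃ f : P → ℕ, IsLocallyConstant f ∧ ∀ p, p ∈ O (f p) := by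
  have hF : ∀ i, ∃ F : P → Baire, Continuous F ∧ ∀ p, p ∈ O i ↔ ∃ n, F p n ≠ 0 := by
    intro i
    obtain ⟨W, hW, hWe⟩ := he.isOpen_iff.1 (hO i)
    obtain ⟨F, hFc, hFW⟩ := exists_semidecision hW
    refine ⟨F ∘ e, hFc.comp he.continuous, fun p => ?_⟩
    rw [← hWe]
    exact hFW (e p)
  choose F hFc hFO using hF
  let v : ℕ → P → ℕ := fun k p => F k.unpair.1 p k.unpair.2
  have hv : ∀ k, IsLocallyConstant (v k) := fun k => by
    rw [IsLocallyConstant.iff_continuous]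
    exact (continuous_apply _).comp (hFc _)
  have hex : ∀ p, ∃ k, v k p ≠ 0 := by
    intro p
    obtain ⟨i, hi⟩ := hcov p
    obtain ⟨n, hn⟩ := (hFO i p).1 hi
    exact ⟨Nat.pair i n, by simpa [v] using hn⟩
  have hN : IsLocallyConstant fun p => Nat.find (hex p) := by
    rw [IsLocallyConstant.iff_eventually_eq]
    intro p
    have hev : ∀ᶠ q in 𝓝 p, ∀ k ∈ Iic (Nat.find (hex p)), v k q = v k p :=
      (eventually_all_finite (finite_Iic _)).2 fun k _ => (hv k).eventually_eq p
    filter_upwards [hev] with q hq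
    rw [Nat.find_eq_iff]
    refine ⟨?_, fun k hk => ?_⟩
    · rw [hq _ (mem_Iic.2 le_rfl)]
      exact Nat.find_spec (hex p)
    · rw [hq _ (mem_Iic.2 hk.le)]
      exact Nat.find_min (hex p) hk
  exact ⟨fun p => (Nat.find (hex p)).unpair.1, hN.comp fun k => k.unpair.1,
    fun p => (hFO _ p).2 ⟨_, Nat.find_spec (hex p)⟩⟩

theorem exists_continuous_of_fibers {X ι : Type*} [TopologicalSpace X] {A : P → Set X} {f : P → ι}
    (hf : IsLocallyConstant f)
    (h : ∀ i, ∃ φ : {p // f p = i} → X, Continuous φ ∧ ∀ p, φ p ∈ A p.1) :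
    ∃ φ : P → X, Continuous φ ∧ ∀ p, φ p ∈ A p := by
  choose φ hφ hA using h
  refine ⟨fun p => φ (f p) ⟨p, rfl⟩, continuous_iff_continuousAt.2 fun p => ?_, fun p => hA _ ⟨p, rfl⟩⟩
  have ho : IsOpen {q | f q = f p} := hf.isOpen_fiber _
  have hp : p ∈ {q | f q = f p} := rfl
  refine ContinuousOn.continuousAt (s := {q | f q = f p}) ?_ (ho.mem_nhds hp)
  rw [continuousOn_iff_continuous_domRestrict]
  refine (hφ (f p)).congr fun q => ?_
  obtain ⟨q, hq⟩ := q
  change φ (f p) ⟨q, hq⟩ = φ (f q) ⟨q, rfl⟩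
  have key : ∀ i (hi : f q = i), φ i ⟨q, hi⟩ = φ (f q) ⟨q, rfl⟩ := by
    rintro _ rfl
    rfl
  exact key _ hq

/-- Intersect `g p` with a ball of radius `ε / 2` about a point of a dense sequence. As `g` is
locally constant, meeting the intersection is an open condition near `p`. -/
theorem exists_shrinking_selection {Y : Type*} [MetricSpace Y] [TopologicalSpace.SeparableSpace Y]
    (he : IsInducing e) {G : Set Y} {B : P → Set Y}
    (hB : ∀ V, IsOpen V → V ⊆ G → IsOpen {p | (B p ∩ V).Nonempty})
    {g : P → Set Y} (hg : IsLocallyConstant g) (hgo : ∀ p, IsOpen (g p)) (hgG : ∀ p, g p ⊆ G)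
    (hgB : ∀ p, (B p ∩ g p).Nonempty) {ε : ℝ} (hε : 0 < ε) :
    ∃ g' : P → Set Y, IsLocallyConstant g' ∧ (∀ p, IsOpen (g' p)) ∧ (∀ p, g' p ⊆ g p) ∧
      (∀ p, (B p ∩ g' p).Nonempty) ∧ ∀ p, ∀ x ∈ g' p, ∀ y ∈ g' p, dist x y < ε := by
  rcases isEmpty_or_nonempty P with hP | ⟨⟨p₀⟩⟩
  · exact ⟨g, hg, hgo, fun p => Subset.rfl, hgB, fun p => hP.elim p⟩
  have : Nonempty Y := ⟨(hgB p₀).choose⟩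
  let d := TopologicalSpace.denseSeq Y
  let V : ℕ → P → Set Y := fun i p => g p ∩ Metric.ball (d i) (ε / 2)
  have hVo : ∀ i p, IsOpen (V i p) := fun i p => (hgo p).inter Metric.isOpen_ball
  obtain ⟨f, hf, hfO⟩ := exists_isLocallyConstant_selection he
    (O := fun i => {p | (B p ∩ V i p).Nonempty}) (fun i => by
      rw [isOpen_iff_mem_nhds]
      intro p hp
      filter_upwards [hg.eventually_eq p, (hB (V i p) (hVo i p)
        (inter_subset_left.trans (hgG p))).mem_nhds hp] with q hq hq'
      change (B q ∩ (g q ∩ _)).Nonempty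
      rw [hq]
      exact hq') (fun p => by
      obtain ⟨b, hb, hbg⟩ := hgB p
      obtain ⟨i, hi⟩ := (TopologicalSpace.denseRange_denseSeq Y).exists_dist_lt b (half_pos hε)
      exact ⟨i, b, hb, hbg, hi⟩)
  refine ⟨fun p => V (f p) p, ?_, fun p => hVo _ p, fun p => inter_subset_left, hfO, ?_⟩
  · exact hf.comp₂ hg fun i s => s ∩ Metric.ball (d i) (ε / 2)
  · intro p x hx y hy
    have h1 := Metric.mem_ball.1 hx.2
    have h2 := Metric.mem_ball'.1 hy.2
    linarith [dist_triangle x (d (f p)) y]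

/-- Iterated shrinking gives locally constant approximations that converge uniformly. The limit may
leave `G`, but it stays in the closed set `B p`. Only open sets inside `G` are tested because, in
the application, a relatively open subset of `K` need be open in the whole space only inside the
interior. -/
theorem exists_continuous_selection {Y : Type*} [MetricSpace Y] [CompleteSpace Y]
    [TopologicalSpace.SeparableSpace Y]
    (he : IsInducing e) {G : Set Y} (hG : IsOpen G) {B : P → Set Y} (hBc : ∀ p, IsClosed (B p))
    (hB : ∀ V, IsOpen V → V ⊆ G → IsOpen {p | (B p ∩ V).Nonempty})
    (hBG : ∀ p, (B p ∩ G).Nonempty) :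
    ∃ φ : P → Y, Continuous φ ∧ ∀ p, φ p ∈ B p := by
  let T := {g : P → Set Y // IsLocallyConstant g ∧ (∀ p, IsOpen (g p)) ∧ (∀ p, g p ⊆ G) ∧
    ∀ p, (B p ∩ g p).Nonempty}
  have hstep : ∀ (n : ℕ) (g : T), ∃ g' : T, (∀ p, g'.1 p ⊆ g.1 p) ∧
      ∀ p, ∀ x ∈ g'.1 p, ∀ y ∈ g'.1 p, dist x y < (1 / 2 : ℝ) ^ n := by
    rintro n ⟨g, h1, h2, h3, h4⟩
    obtain ⟨g', k1, k2, k3, k4, k5⟩ :=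
      exists_shrinking_selection he hB h1 h2 h3 h4 (ε := (1 / 2 : ℝ) ^ n) (by positivity)
    exact ⟨⟨g', k1, k2, fun p => (k3 p).trans (h3 p), k4⟩, k3, k5⟩
  choose s hs hsd using hstep
  let g : ℕ → T := fun n => Nat.rec
    ⟨fun _ => G, IsLocallyConstant.const G, fun _ => hG, fun _ => Subset.rfl, hBG⟩
    (fun n g => s n g) n
  have hanti : ∀ p, Antitone fun n => (g n).1 p := fun p =>
    antitone_nat_of_succ_le fun n => hs n (g n) p
  have hdist : ∀ n p, ∀ x ∈ (g (n + 1)).1 p, ∀ y ∈ (g (n + 1)).1 p,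
      dist x y < (1 / 2 : ℝ) ^ n := fun n p => hsd n (g n) p
  have hne : ∀ n p, ((g n).1 p).Nonempty := fun n p => ((g n).2.2.2.2 p).mono inter_subset_right
  classical
  -- On nonempty sets the choice depends on `S` alone, so it inherits local constancy from `g`; the
  -- default is never reached.
  let pick : P → Set Y → Y := fun p S =>
    if h : S.Nonempty then h.some else (hne 0 p).some
  have hpick : ∀ p S, S.Nonempty → pick p S ∈ S := fun p S h => by
    simp only [pick, dif_pos h]
    exact h.some_mem
  let c : ℕ → P → Y := fun n p => pick p ((g (n + 1)).1 p)
  have hcg : ∀ n p, c n p ∈ (g (n + 1)).1 p := fun n p => hpick _ _ (hne (n + 1) p)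
  have hcc : ∀ n, Continuous (c n) := by
    intro n
    refine IsLocallyConstant.continuous ?_
    rw [IsLocallyConstant.iff_eventually_eq]
    intro p
    filter_upwards [(g (n + 1)).2.1.eventually_eq p] with q hq
    simp only [c, pick, hq, dif_pos (hne (n + 1) p)]
  have hcd : ∀ p n m, n ≤ m → dist (c n p) (c m p) < (1 / 2 : ℝ) ^ n := fun p n m hnm =>
    hdist n p _ (hcg n p) _ (hanti p (Nat.succ_le_succ hnm) (hcg m p))
  have hlim0 : Tendsto (fun n : ℕ => (1 / 2 : ℝ) ^ n) atTop (𝓝 0) :=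
    tendsto_pow_atTop_nhds_zero_of_lt_one (by norm_num) (by norm_num)
  have hex : ∀ p, ∃ x, Tendsto (fun n => c n p) atTop (𝓝 x) := fun p =>
    cauchySeq_tendsto_of_complete
      (cauchySeq_of_le_tendsto_0' _ (fun n m hnm => (hcd p n m hnm).le) hlim0)
  choose φ hφ using hex
  have hφd : ∀ n p, dist (c n p) (φ p) ≤ (1 / 2 : ℝ) ^ n := fun n p =>
    le_of_tendsto (tendsto_const_nhds.dist (hφ p))
      (eventually_atTop.2 ⟨n, fun m hm => (hcd p n m hm).le⟩)
  refine ⟨φ, ?_, fun p => ?_⟩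
  · have hu : TendstoUniformly c φ atTop := by
      rw [Metric.tendstoUniformly_iff]
      intro ε hε
      filter_upwards [hlim0.eventually (gt_mem_nhds hε)] with n hn p
      rw [dist_comm]
      exact (hφd n p).trans_lt hn
    exact hu.continuous (Frequently.of_forall hcc)
  -- The approximations `c n p` need not lie in `B p`, but nearby points `b n` do and have the same
  -- limit.
  · choose b hb hbg using fun n => (g (n + 1)).2.2.2.2 p
    refine (hBc p).mem_of_tendsto (f := b) (b := atTop) ?_ (Eventually.of_forall hb)
    refine (hφ p).congr_dist ?_
    exact squeeze_zero (fun _ => dist_nonneg)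
      (fun n => (hdist n p _ (hcg n p) _ (hbg n)).le) hlim0

theorem exists_continuous_selection_of_interior {X : Type*} [TopologicalSpace X]
    (he : IsInducing e) {K : Set X} (hK : IsCompact K)
    (hmet : TopologicalSpace.MetrizableSpace K) {A : P → Set X} (hAc : ∀ p, IsClosed (A p))
    (hA : ∀ V, IsOpen V → IsOpen {p | (A p ∩ V).Nonempty})
    (hAK : ∀ p, (A p ∩ interior K).Nonempty) :
    ∃ φ : P → X, Continuous φ ∧ ∀ p, φ p ∈ A p := by
  let := TopologicalSpace.metrizableSpaceMetric K
  have : CompactSpace K := isCompact_iff_compactSpace.1 hK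
  obtain ⟨φ, hφ, hφA⟩ := exists_continuous_selection (Y := K) he
    (G := (↑) ⁻¹' interior K) (B := fun p => (↑) ⁻¹' A p)
    (isOpen_interior.preimage continuous_subtype_val)
    (fun p => (hAc p).preimage continuous_subtype_val)
    (fun V hV hVG => by
      obtain ⟨W, hW, rfl⟩ := isOpen_induced_iff.1 hV
      convert hA (W ∩ interior K) (hW.inter isOpen_interior) using 3 with p
      constructor
      · rintro ⟨x, hx, hxW⟩
        exact ⟨x, hx, hxW, hVG hxW⟩
      · rintro ⟨x, hx, hxW, hxK⟩
        exact ⟨⟨x, interior_subset hxK⟩, hx, hxW⟩)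
    (fun p => by
      obtain ⟨x, hx, hxK⟩ := hAK p
      exact ⟨⟨x, interior_subset hxK⟩, hx, hxK⟩)
  exact ⟨fun p => φ p, continuous_subtype_val.comp hφ, hφA⟩

theorem exists_continuous_selection_of_iUnion_interior {X : Type*} [TopologicalSpace X]
    (he : IsInducing e) {K : ℕ → Set X} (hK : ∀ k, IsCompact (K k))
    (hmet : ∀ k, TopologicalSpace.MetrizableSpace (K k))
    {A : P → Set X} (hAc : ∀ p, IsClosed (A p))
    (hA : ∀ V, IsOpen V → IsOpen {p | (A p ∩ V).Nonempty})
    (hAK : ∀ p, (A p ∩ ⋃ k, interior (K k)).Nonempty) :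
    ∃ φ : P → X, Continuous φ ∧ ∀ p, φ p ∈ A p := by
  obtain ⟨f, hf, hfA⟩ := exists_isLocallyConstant_selection he
    (O := fun k => {p | (A p ∩ interior (K k)).Nonempty}) (fun k => hA _ isOpen_interior)
    (fun p => by
      obtain ⟨x, hx, hxK⟩ := hAK p
      obtain ⟨k, hk⟩ := mem_iUnion.1 hxK
      exact ⟨k, x, hx, hk⟩)
  refine exists_continuous_of_fibers hf fun k => ?_
  refine exists_continuous_selection_of_interior (he.comp IsInducing.subtypeVal) (hK k) (hmet k)
    (fun p => hAc p) (fun V hV => (hA V hV).preimage continuous_subtype_val) fun p => ?_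
  have h := hfA p.1
  rw [p.2] at h
  exact h

/-- For `A p ⊆ D`, the point `d i` is in `A p` exactly when `A p` meets the complement of `D \ {d
i}`, which is open. -/
theorem exists_continuous_selection_of_discrete {X : Type*} [TopologicalSpace X]
    (he : IsInducing e) {D : Set X} (hD : D.Countable) (hDc : ∀ E ⊆ D, IsClosed E)
    {A : P → Set X} (hA : ∀ V, IsOpen V → IsOpen {p | (A p ∩ V).Nonempty})
    (hAn : ∀ p, (A p).Nonempty) (hAD : ∀ p, A p ⊆ D) :
    ∃ φ : P → X, Continuous φ ∧ ∀ p, φ p ∈ A p := by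
  rcases isEmpty_or_nonempty P with hP | ⟨⟨p₀⟩⟩
  · exact ⟨hP.elim, continuous_of_discreteTopology, hP.elim⟩
  obtain ⟨d, rfl⟩ := hD.exists_eq_range ((hAn p₀).mono (hAD p₀))
  have hmem : ∀ p i, (A p ∩ (range d \ {d i})ᶜ).Nonempty → d i ∈ A p := by
    rintro p i ⟨x, hx, hxi⟩
    by_contra h
    exact hxi ⟨hAD p hx, fun hxd => h (mem_singleton_iff.1 hxd ▸ hx)⟩
  obtain ⟨f, hf, hfA⟩ := exists_isLocallyConstant_selection he
    (O := fun i => {p | (A p ∩ (range d \ {d i})ᶜ).Nonempty})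
    (fun i => hA _ (hDc _ sdiff_subset).isOpen_compl)
    (fun p => by
      obtain ⟨x, hx⟩ := hAn p
      obtain ⟨i, rfl⟩ := hAD p hx
      exact ⟨i, d i, hx, fun h => h.2 rfl⟩)
  exact ⟨fun p => d (f p), (hf.comp d).continuous, fun p => hmem p _ (hfA p)⟩

end Selection

/-! ### The reduction to `LPO` -/

section Weihrauch

/-- The left component of a pair of sequences. -/
def evenPart (s : Baire) : Baire := fun n => s (2 * n)

theorem continuous_evenPart : Continuous evenPart :=
  continuous_pi fun _ => continuous_apply _

@[simp]
theorem evenPart_pair (p q : Baire) : evenPart (pair p q) = p := by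
  funext n
  simp [evenPart, pair]

@[simp]
theorem pair_one (p q : Baire) : pair p q 1 = q 0 := by
  simp [pair]

/-- Whether a named overt set meets a fixed open set is an open condition on the name. -/
theorem exists_isOpen_forall_names_overt (X : RepSpace) {U : Set X} (hU : IsOpen U) :
    ∃ W : Set Baire, IsOpen W ∧
      ∀ p (A : X.overt), X.overt.names p A → (p ∈ W ↔ (A.1 ∩ U).Nonempty) := by
  obtain ⟨u, hu⟩ := X.opens.names_surj ⟨fun x => x ∈ U, RepSpace.repContinuous_of_isOpen hU⟩
  -- Evaluate `η_p` at the fixed name `u` of `U`. Codes store digits shifted by one, so a nonzero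
  -- digit is a first nonzero value above `1`, which finitely many digits of `p` witness.
  refine ⟨⋃ n, ⋃ m, {p : Baire | 1 < p (code n (initSeg u m))} ∩
    ⋂ k ∈ Iio m, {p : Baire | p (code n (initSeg u k)) = 0}, ?_, fun p A hp => ?_⟩
  · refine isOpen_iUnion fun n => isOpen_iUnion fun m => IsOpen.inter ?_ ?_
    · exact (isOpen_discrete (Ioi 1)).preimage (continuous_apply (code n (initSeg u m)))
    · exact (finite_Iio m).isOpen_biInter fun k _ =>
        (isOpen_discrete {0}).preimage (continuous_apply (code n (initSeg u k)))
  · obtain ⟨r, ⟨hd, hr⟩, y, hy, hry⟩ := hp u _ hu ⟨_, rfl⟩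
    rw [mem_singleton_iff] at hy
    subst hy
    have hrn : ∀ n, p (code n (initSeg u (Nat.find (hd n)))) - 1 = r n := congrFun hr
    refine Iff.trans ?_ hry.symm
    simp only [mem_iUnion, mem_inter_iff, mem_iInter, mem_Iio]
    refine exists_congr fun n => ?_
    rw [← hrn n]
    constructor
    · rintro ⟨m, h1, h2⟩
      have h1' : 1 < p (code n (initSeg u m)) := h1
      have hm : Nat.find (hd n) = m :=
        (Nat.find_eq_iff _).2 ⟨by omega, fun k hk => by simpa using h2 k hk⟩
      rw [hm]
      omega
    · intro h
      refine ⟨Nat.find (hd n), ?_, fun k hk => by simpa using Nat.find_min (hd n) hk⟩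
      change 1 < p (code n (initSeg u (Nat.find (hd n))))
      omega

open Classical in
/-- Overt choice reduces to `LPO` if it is solved continuously both on the sets that meet a fixed
open set and on those that do not. -/
theorem VC_le_LPO_of_selection {X : RepSpace} (hX : X.IsAdmissible) {U : Set X} (hU : IsOpen U)
    (hsel : ∀ (P : Type) [TopologicalSpace P] (e : P → Baire), IsInducing e →
      ∀ A : P → Set X, (∀ p, IsClosed (A p)) → (∀ p, (A p).Nonempty) →
      (∀ V, IsOpen V → IsOpen {p | (A p ∩ V).Nonempty}) →
      ((∀ p, (A p ∩ U).Nonempty) ∨ ∀ p, A p ⊆ Uᶜ) →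
      ∃ φ : P → X, Continuous φ ∧ ∀ p, φ p ∈ A p) :
    TopWeihrauchLE (VC X) LPO := by
  obtain ⟨W, hW, hWU⟩ := exists_isOpen_forall_names_overt X hU
  obtain ⟨F, hFc, hFW⟩ := exists_semidecision hW
  -- The inputs `pair p r` with `p` a name of a nonempty set and `r` a correct answer; position `1`
  -- of the pair is `r 0`.
  let S : Set Baire := {s | (∃ B : X.overt, X.overt.names (evenPart s) B ∧ B.1.Nonempty) ∧
    (s 1 = 1 ↔ evenPart s ∈ W)}
  choose B hB hBn using fun s : S => s.2.1
  have hlsc : ∀ V, IsOpen V → IsOpen {s : S | ((B s).1 ∩ V).Nonempty} := by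
    intro V hV
    obtain ⟨W', hW', hWV⟩ := exists_isOpen_forall_names_overt X hV
    convert hW'.preimage (continuous_evenPart.comp (continuous_subtype_val (p := (· ∈ S))))
      using 1
    ext s
    exact (hWV _ _ (hB s)).symm
  have hanswer : IsLocallyConstant fun s : S => s.1 1 = 1 := by
    refine IsLocallyConstant.comp (f := fun s : S => s.1 1) ?_ (· = 1)
    rw [IsLocallyConstant.iff_continuous]
    exact (continuous_apply 1).comp continuous_subtype_val
  obtain ⟨φ, hφ, hφB⟩ := exists_continuous_of_fibers (X := X) (A := fun s => (B s).1) hanswer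
    (fun b => by
      refine hsel {s : S // (s.1 1 = 1) = b} (fun p => p.1.1)
        (IsInducing.subtypeVal.comp IsInducing.subtypeVal)
        (fun p => (B p.1).1) (fun p => (B p.1).2) (fun p => hBn p.1)
        (fun V hV => (hlsc V hV).preimage continuous_subtype_val) ?_
      have key : ∀ p : {s : S // (s.1 1 = 1) = b}, b ↔ ((B p.1).1 ∩ U).Nonempty := fun p => by
        rw [← hWU _ _ (hB p.1), ← p.1.2.2, p.2]
      by_cases hb : b
      · exact Or.inl fun p => (key p).1 hb
      · exact Or.inr fun p x hx hxU => hb ((key p).2 ⟨x, hx, hxU⟩))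
  obtain ⟨g, hg, hgφ⟩ := hX S φ hφ
  -- `LPO` searches for a zero while `F` signals success by a nonzero digit, so the two are swapped.
  let H : Baire → Baire := fun p n => if F p n = 0 then 1 else 0
  have hH : Continuous H := continuous_pi fun n =>
    (continuous_of_discreteTopology (f := fun k : ℕ => if k = 0 then 1 else 0)).comp
      ((continuous_apply n).comp hFc)
  refine ⟨H, fun s => ⟨s ∈ S, fun h => g ⟨s, h⟩⟩, hH.comp continuous_subtype_val, hg, ?_⟩
  intro G hG p C hC hCn
  obtain ⟨r, hr, y, hy, hry⟩ := hG (H p) (H p) rfl ⟨_, rfl⟩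
  have hr0 : r 0 = 1 ↔ p ∈ W := by
    have hyr : r 0 = y.val := hry
    have hex : (∃ k, H p k = 0) ↔ p ∈ W := by
      rw [hFW]
      refine exists_congr fun k => ?_
      simp [H]
    have hy' : y = if ∃ k, H p k = 0 then (1 : Fin 2) else 0 := mem_singleton_iff.1 hy
    rw [hyr, hy', ← hex]
    split_ifs with h <;> simp [h]
  have hs : pair p r ∈ S := by
    refine ⟨⟨C, ?_, hCn⟩, ?_⟩
    · rwa [evenPart_pair]
    · rwa [evenPart_pair, pair_one]
  have hBC : B ⟨pair p r, hs⟩ = C := by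
    refine X.overt.names_unique (hB _) ?_
    rwa [evenPart_pair]
  refine ⟨g ⟨_, hs⟩, ?_, φ ⟨_, hs⟩, ?_, hgφ _⟩
  · simp only [Part.mem_bind_iff]
    exact ⟨H p, Part.mem_some _, r, hr, hs, rfl⟩
  · exact hBC ▸ hφB ⟨_, hs⟩

end Weihrauch

end OvertChoice

theorem mainTheorem7 (X : OvertChoice.RepSpace) (hX : X.IsAdmissible)
    (hCoPolish : OvertChoice.IsCoPolish X) (hFU : FrechetUrysohnSpace X) :
    OvertChoice.TopWeihrauchLE (OvertChoice.VC X) OvertChoice.LPO := by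
  obtain ⟨K, hmono, hcpt, hmet, hcover, hcoh⟩ := hCoPolish
  refine OvertChoice.VC_le_LPO_of_selection hX (U := ⋃ k, interior (K k))
    (isOpen_iUnion fun k => isOpen_interior) fun P _ e he A hAc hAn hA h => ?_
  rcases h with h | h
  · exact OvertChoice.exists_continuous_selection_of_iUnion_interior he hcpt hmet hAc hA h
  · exact OvertChoice.exists_continuous_selection_of_discrete he
      (OvertChoice.countable_singularSet hmono hcpt hmet hcover hcoh)
      (fun E hE =>
        OvertChoice.isClosed_of_subset_singularSet hmono hcpt hmet hcover hcoh hE)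
      hA hAn h
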